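/- Let $K$ be an infinite field, $n\ge 1$, and let $E=K\langle e_1,\dots,e_n\rangle$ be the exterior algebra with its standard grading. For a graded ideal $J\subseteq E$ and a basis $v_1,\dots,v_n$ of $E_1$ put $$\alpha_{i,j}(v_1,\dots,v_n;E/J)=\dim_K H^j\big(E/(J+(v_1,\dots,v_{i-1})),v_i\big)\qquad(1\le i\le n,\ j\in\mathbb Z),$$ where, for a graded $E$-module $N$ and $v\in E_1$, $H^j(N,v)$ is the homology at $N_j$ of the complex $\cdots\to N_{j-1}\xrightarrow{\cdot v}N_j\xrightarrow{\cdot v}N_{j+1}\to\cdots$. Let $\operatorname{gin}(J)$ be the generic initial ideal of $J$ with respect to the reverse lexicographic order with $e_1<\dots<e_n$, that is, the common initial ideal of $\varphi(J)$ for all $\varphi$ in a non-empty Zariski-open subset of $\mathrm{GL}_n(K)$. The exterior generic annihilator numbers of $E/J$ are $\alpha_{i,j}(E/J)=\alpha_{i,j}(e_1,\dots,e_n;E/\operatorname{gin}(J))$. Let $i\ge 2$ and $j\ge 1$ be integers with $i+j\le n$, let $$J=(e_{l_1}\cdots e_{l_{j+1}} : i\le l_1<l_2<\dots<l_{j+1}\le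 n)\subseteq E,$$ and let $\mathbf e=e_1,\dots,e_{i-2},e_i,e_{i-1},e_{i+1},\dots,e_n$. Then $J$ is a graded ideal; it is strongly stable (it is generated by monomials, and whenever $e_A\in J$, $a\in A$, $b\notin A$ and $a<b$, also $e_b\,e_{A\setminus\{a\}}\in J$); and $\operatorname{gin}(J)=J$. Moreover $$\alpha_{i,j}(\mathbf e;E/J)<\alpha_{i,j}(E/J)\qquad\text{and}\qquad \alpha_{i-1,j}(E/J)<\alpha_{i-1,j}(\mathbf e;E/J).$$ In particular, Herzog's conjecture, that $\alpha_{k,d}(E/I)\le\alpha_{k,d}(v_1,\dots,v_n;E/I)$ for every graded ideal $I\subseteq E$, every basis $v_1,\dots,v_n$ of $E_1$, all $1\le k\le n$ and all $d\ge 0$, fails over this $K$ and for this $n$. -/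

import Mathlib

namespace ExtAnn

/-- The exterior algebra `E = K⟨e_1, …, e_n⟩`. Its degree one part is `Fin n → K`, embedded by
`ExteriorAlgebra.ι`. All indices in `Fin n` are zero-based: the element `k : Fin n` stands for the
index `k + 1` in the one-based numbering `1, …, n`. -/
abbrev Ext (K : Type*) [Field K] (n : ℕ) : Type _ := ExteriorAlgebra K (Fin n → K)

/-- The variable `e_k`. -/
noncomputable def e (K : Type*) [Field K] {n : ℕ} (k : Fin n) : Ext K n :=
  ExteriorAlgebra.ι K (Pi.basisFun K (Fin n) k)

/-- The monomial `e_A = e_{a_1} ∧ … ∧ e_{a_r}` for `A = {a_1 < … < a_r}`. -/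
noncomputable def monomial (K : Type*) [Field K] {n : ℕ} (A : Finset (Fin n)) : Ext K n :=
  (Pi.basisFun K (Fin n)).ExteriorAlgebra A

/-- The coefficient of the monomial `e_A` in `f`. -/
noncomputable def coeff {K : Type*} [Field K] {n : ℕ} (f : Ext K n) (A : Finset (Fin n)) : K :=
  (Pi.basisFun K (Fin n)).ExteriorAlgebra.repr f A

/-- The homogeneous component `E_j`, for `j ∈ ℤ`. -/
noncomputable def gradedPart (K : Type*) [Field K] (n : ℕ) : ℤ → Submodule K (Ext K n)
  | Int.ofNat d => ⋀[K]^d (Fin n → K)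
  | Int.negSucc _ => ⊥

/-- A graded ideal. (A graded left ideal of `E` is automatically two-sided.) -/
def IsGraded {K : Type*} [Field K] {n : ℕ} (J : Ideal (Ext K n)) : Prop :=
  J.IsHomogeneous (fun d : ℕ => ⋀[K]^d (Fin n → K))

section Homology

variable {K : Type*} [Field K] {n : ℕ} {N : Type*} [AddCommGroup N] [Module K N]
  [Module (Ext K n) N] [IsScalarTower K (Ext K n) N]

/-- Multiplication by the linear form `w` on an `E`-module. -/
noncomputable def mulForm (N : Type*) [AddCommGroup N] [Module K N]
    [Module (Ext K n) N] [IsScalarTower K (Ext K n) N] (w : Fin n → K) : N →ₗ[K] N :=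
  Algebra.lsmul K K N (ExteriorAlgebra.ι K w)

/-- Cycles of degree `j` of the complex `… → N_{j-1} → N_j → N_{j+1} → …` with maps `· w`. -/
noncomputable def cycles (𝒩 : ℤ → Submodule K N) (w : Fin n → K) (j : ℤ) : Submodule K N :=
  𝒩 j ⊓ LinearMap.ker (mulForm N w)

/-- Boundaries of degree `j` of the same complex. -/
noncomputable def boundaries (𝒩 : ℤ → Submodule K N) (w : Fin n → K) (j : ℤ) : Submodule K N :=
  (𝒩 (j - 1)).map (mulForm N w)

/-- The homology `H^j(N, w)`. -/
abbrev Homology (𝒩 : ℤ → Submodule K N) (w : Fin n → K) (j : ℤ) : Type _ :=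
  ↥(cycles 𝒩 w j) ⧸ (boundaries 𝒩 w j).submoduleOf (cycles 𝒩 w j)

end Homology

section AnnihilatorNumbers

variable {K : Type*} [Field K] {n : ℕ}

/-- The submodule `(v_1, …, v_{i-1}) M`, generated by all `v_k m` with `k < i` and `m ∈ M`. -/
def formsSubmodule (M : Type*) [AddCommGroup M] [Module (Ext K n) M]
    (v : Fin n → Fin n → K) (i : Fin n) : Submodule (Ext K n) M :=
  Submodule.span (Ext K n) {x | ∃ k, k < i ∧ ∃ m : M, x = ExteriorAlgebra.ι K (v k) • m}

/-- The grading induced by `ℳ` on the quotient of `M` by the submodule `P`. -/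
def quotientGrading {M : Type*} [AddCommGroup M] [Module K M] [Module (Ext K n) M]
    [IsScalarTower K (Ext K n) M] (ℳ : ℤ → Submodule K M) (P : Submodule (Ext K n) M) (j : ℤ) :
    Submodule K (M ⧸ P) :=
  (ℳ j).map (P.mkQ.restrictScalars K)

/-- The exterior annihilator number
`α_{i,j}(v_1, …, v_n; M) = dim_K H^j(M / (v_1, …, v_{i-1}) M, v_i)` of the graded `E`-module `M`
with homogeneous components `ℳ j`, with respect to the basis `v` of `E_1`. -/
noncomputable def annihilatorNumber {M : Type*} [AddCommGroup M] [Module K M] [Module (Ext K n) M]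
    [IsScalarTower K (Ext K n) M] (ℳ : ℤ → Submodule K M)
    (v : Module.Basis (Fin n) K (Fin n → K)) (i : Fin n) (j : ℤ) : ℕ :=
  Module.finrank K (Homology (quotientGrading ℳ (formsSubmodule M v i)) (v i) j)

/-- `α_{i,j}(v_1, …, v_n; E/J)`. -/
noncomputable def idealAnnihilatorNumber (J : Ideal (Ext K n))
    (v : Module.Basis (Fin n) K (Fin n → K)) (i : Fin n) (j : ℤ) : ℕ :=
  annihilatorNumber (M := Ext K n ⧸ J) (quotientGrading (gradedPart K n) J) v i j

end AnnihilatorNumbers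

section GenericInitialIdeal

variable {K : Type*} [Field K] {n : ℕ}

/-- The (degree) reverse lexicographic order on monomials with respect to `e_1 < … < e_n`:
for `|A| = |B|`, `e_A < e_B` if and only if the minimum of the symmetric difference of `A` and `B`
lies in `A`. -/
def RevLexLT (A B : Finset (Fin n)) : Prop :=
  A.card < B.card ∨ (A.card = B.card ∧ ∃ a ∈ A \ B, ∀ b ∈ B \ A, a < b)

/-- `e_A` is the initial (i.e. largest) monomial of `f` in the reverse lexicographic order. -/
def IsInitialMonomial (f : Ext K n) (A : Finset (Fin n)) : Prop :=
  coeff f A ≠ 0 ∧ ∀ B, coeff f B ≠ 0 → B ≠ A → RevLexLT B A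

/-- The initial ideal of `J` in the reverse lexicographic order. -/
def initialIdeal (J : Ideal (Ext K n)) : Ideal (Ext K n) :=
  Ideal.span {x | ∃ f ∈ J, ∃ A, IsInitialMonomial f A ∧ x = monomial K A}

/-- The image `φ(J)` of `J` under the automorphism of `E` induced by `φ ∈ GL_n(K)`. -/
noncomputable def transform (φ : GL (Fin n) K) (J : Ideal (Ext K n)) : Ideal (Ext K n) :=
  J.map (ExteriorAlgebra.map (Matrix.toLin' (φ : Matrix (Fin n) (Fin n) K)))

/-- Zariski-open subsets of `GL_n(K)`: unions of nonvanishing loci of polynomials in the matrix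
entries. -/
def IsZariskiOpen (U : Set (GL (Fin n) K)) : Prop :=
  ∃ S : Set (MvPolynomial (Fin n × Fin n) K),
    U = {φ : GL (Fin n) K | ∃ P ∈ S,
      MvPolynomial.eval (fun ab => (φ : Matrix (Fin n) (Fin n) K) ab.1 ab.2) P ≠ 0}

/-- `I` is the generic initial ideal of `J`: it is the initial ideal of `φ(J)` for all `φ` in a
non-empty Zariski-open subset of `GL_n(K)`. -/
def IsGenericInitialIdeal (J I : Ideal (Ext K n)) : Prop :=
  ∃ U : Set (GL (Fin n) K), IsZariskiOpen U ∧ U.Nonempty ∧ ∀ φ ∈ U, initialIdeal (transform φ J) = I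

/-- The generic initial ideal `gin(J)` with respect to the reverse lexicographic order (for an
infinite field `K` and graded `J`, it is the unique ideal with `IsGenericInitialIdeal J (gin J)`).
-/
noncomputable def gin (J : Ideal (Ext K n)) : Ideal (Ext K n) :=
  Classical.epsilon (IsGenericInitialIdeal J)

/-- The exterior generic annihilator numbers
`α_{i,j}(E/J) = α_{i,j}(e_1, …, e_n; E/gin(J))`. -/
noncomputable def genericAnnihilatorNumber (J : Ideal (Ext K n)) (i : Fin n) (j : ℤ) : ℕ :=
  idealAnnihilatorNumber (gin J) (Pi.basisFun K (Fin n)) i j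

/-- A strongly stable (monomial) ideal. -/
def IsStronglyStable (J : Ideal (Ext K n)) : Prop :=
  (∃ S : Set (Finset (Fin n)), J = Ideal.span (monomial K '' S)) ∧
    ∀ A : Finset (Fin n), monomial K A ∈ J → ∀ a ∈ A, ∀ b, b ∉ A → a < b →
      e K b * monomial K (A.erase a) ∈ J

end GenericInitialIdeal

/-- Herzog's conjecture for the field `K` and `n` variables: for every graded ideal `J` of `E` the
generic annihilator numbers of `E/J` are minimal among the annihilator numbers of `E/J` with respect
to bases of `E_1`. -/
def HerzogConjecture (K : Type*) [Field K] (n : ℕ) : Prop :=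
  ∀ J : Ideal (Ext K n), IsGraded J → ∀ v : Module.Basis (Fin n) K (Fin n → K),
    ∀ (i : Fin n) (j : ℕ), genericAnnihilatorNumber J i j ≤ idealAnnihilatorNumber J v i j

/-- The ideal generated by the monomials `e_{l_1} ⋯ e_{l_{j+1}}` with
`i ≤ l_1 < … < l_{j+1} ≤ n`. -/
def exampleIdeal (K : Type*) [Field K] {n : ℕ} (i : Fin n) (j : ℕ) : Ideal (Ext K n) :=
  Ideal.span {x | ∃ A : Finset (Fin n), A.card = j + 1 ∧ (∀ l ∈ A, i ≤ l) ∧ x = monomial K A}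

/-- The standard basis of `E_1` with `e_a` and `e_b` interchanged. -/
noncomputable def swappedBasis (K : Type*) [Field K] {n : ℕ} (a b : Fin n) :
    Module.Basis (Fin n) K (Fin n → K) :=
  (Pi.basisFun K (Fin n)).reindex (Equiv.swap a b)

end ExtAnn

/-!
The two strict inequalities hold because one side is zero and the other is positive, and both facts
are read off from monomials. If `J` is a monomial ideal and `v` a permutation of the variables,
then `E/(J + (v_1, …, v_{i-1}))` is again the quotient of `E` by a monomial ideal
(`mk_mk_eq_zero_iff`), so that membership is decided monomial by monomial
(`mem_span_monomial_image`). If `v_i` divides no generator of `J`, this quotient is free over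
`K⟨v_i⟩` and the complex is exact (`idealAnnihilatorNumber_eq_zero`). This applies to both of the
sequences at the position where `e_{i-1}` stands. Where `e_i` stands, all earlier variables are
smaller than `e_i`, and `e_{i+1} ⋯ e_{i+j}` is a cycle, since its product with `e_i` is a generator
of `J`, but not a boundary, since `e_i` does not divide it (`idealAnnihilatorNumber_pos`).

For `gin(J) = J`, let `W` be the span of the variables `e_i, …, e_n`. Then `J` is generated by the
products of `j + 1` elements of `W` (`exampleIdeal_eq_powerIdeal`), so `φ(J)` depends only on
`φ(W)`. If the block of `φ` on `W` is invertible, an open condition satisfied by the identity, then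
`φ(W) = u(W)` for a unipotent `u` that adds to each of `e_i, …, e_n` a combination of
`e_1, …, e_{i-1}` and fixes the latter (`exists_map_range_eq`). Such a substitution changes a
monomial only by smaller ones (`coeff_map_monomial_sub`), so it preserves initial monomials, and
`φ(J) = u(J)` has the initial ideal of the monomial ideal `J`, which is `J`. Since `K` is infinite,
non-empty Zariski-open sets meet, and the generic initial ideal is unique.
-/

open ExteriorAlgebra

namespace ExtAnn

/-! ### Coefficients and monomials -/

section Coefficients

variable {K : Type*} [Field K] {n : ℕ}

@[simp]
lemma coeff_zero (A : Finset (Fin n)) : coeff (0 : Ext K n) A = 0 := by simp [coeff]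

@[simp]
lemma coeff_add (f g : Ext K n) (A : Finset (Fin n)) :
    coeff (f + g) A = coeff f A + coeff g A := by simp [coeff]

@[simp]
lemma coeff_sub (f g : Ext K n) (A : Finset (Fin n)) :
    coeff (f - g) A = coeff f A - coeff g A := by simp [coeff]

@[simp]
lemma coeff_smul (c : K) (f : Ext K n) (A : Finset (Fin n)) :
    coeff (c • f) A = c * coeff f A := by simp [coeff]

lemma coeff_sum {κ : Type*} (s : Finset κ) (f : κ → Ext K n) (A : Finset (Fin n)) :
    coeff (∑ k ∈ s, f k) A = ∑ k ∈ s, coeff (f k) A := by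
  simp [coeff, map_sum, Finsupp.finsetSum_apply]

lemma coeff_monomial (A B : Finset (Fin n)) :
    coeff (monomial K A) B = if A = B then 1 else 0 := by
  simp [coeff, monomial, Finsupp.single_apply]

@[simp]
lemma coeff_monomial_self (A : Finset (Fin n)) : coeff (monomial K A) A = 1 := by
  simp [coeff_monomial]

lemma sum_coeff_smul_monomial (f : Ext K n) : ∑ A, coeff f A • monomial K A = f :=
  (Pi.basisFun K (Fin n)).ExteriorAlgebra.sum_repr f

lemma monomial_eq_ιMulti (A : Finset (Fin n)) {d : ℕ} (h : A.card = d) :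
    monomial K A = ιMulti K d (fun k => Pi.basisFun K (Fin n) (A.orderEmbOfFin h k)) := by
  rw [monomial, basis_apply_ofCard _ h]
  rfl

lemma monomial_singleton (k : Fin n) : monomial K {k} = e K k := by
  rw [monomial_eq_ιMulti {k} (Finset.card_singleton k)]
  simp [e]

lemma monomial_empty : monomial K (∅ : Finset (Fin n)) = 1 := by
  rw [monomial_eq_ιMulti ∅ Finset.card_empty, ιMulti_zero_apply]

lemma ι_eq_sum (x : Fin n → K) : ι K x = ∑ k, x k • e K k := by
  conv_lhs => rw [← (Pi.basisFun K (Fin n)).sum_repr x]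
  simp [e, map_sum]

lemma monomial_mul_of_not_disjoint {A B : Finset (Fin n)} (h : ¬ Disjoint A B) :
    monomial K A * monomial K B = 0 :=
  basis_mul_of_not_disjoint (Pi.basisFun K (Fin n)) (m := A.card) (n := B.card) ⟨A, rfl⟩ ⟨B, rfl⟩ h

lemma monomial_mul_of_disjoint {A B : Finset (Fin n)} (h : Disjoint A B) :
    ∃ ε : K, ε ≠ 0 ∧ monomial K A * monomial K B = ε • monomial K (A ∪ B) := by
  obtain ⟨s, hs⟩ : ∃ s : ℤˣ, monomial K A * monomial K B = s • monomial K (A ∪ B) := by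
    rw [← Finset.disjUnion_eq_union A B h]
    exact ⟨_, basis_mul_of_disjoint (Pi.basisFun K (Fin n)) (m := A.card) (n := B.card)
      ⟨A, rfl⟩ ⟨B, rfl⟩ h⟩
  refine ⟨((s : ℤ) : K), ?_, ?_⟩
  · rcases Int.units_eq_one_or s with rfl | rfl <;> simp
  · rw [Int.cast_smul_eq_zsmul, hs, Units.smul_def]

lemma exists_of_coeff_mul_ne_zero {f g : Ext K n} {C : Finset (Fin n)} (h : coeff (f * g) C ≠ 0) :
    ∃ A B, coeff f A ≠ 0 ∧ coeff g B ≠ 0 ∧ Disjoint A B ∧ C = A ∪ B := by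
  rw [← sum_coeff_smul_monomial f, ← sum_coeff_smul_monomial g, Finset.sum_mul_sum,
    coeff_sum] at h
  obtain ⟨A, -, hA⟩ := Finset.exists_ne_zero_of_sum_ne_zero h
  rw [coeff_sum] at hA
  obtain ⟨B, -, hB⟩ := Finset.exists_ne_zero_of_sum_ne_zero hA
  rw [smul_mul_smul_comm, coeff_smul] at hB
  have h1 := left_ne_zero_of_mul hB
  have h2 := right_ne_zero_of_mul hB
  by_cases hd : Disjoint A B
  · obtain ⟨ε, -, h3⟩ := monomial_mul_of_disjoint (K := K) hd
    rw [h3, coeff_smul, coeff_monomial] at h2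
    refine ⟨A, B, left_ne_zero_of_mul h1, right_ne_zero_of_mul h1, hd, ?_⟩
    by_contra hC
    simp [Ne.symm hC] at h2
  · simp [monomial_mul_of_not_disjoint hd] at h2

lemma exists_of_coeff_ι_ne_zero {x : Fin n → K} {C : Finset (Fin n)} (h : coeff (ι K x) C ≠ 0) :
    ∃ k, C = {k} ∧ x k ≠ 0 := by
  rw [ι_eq_sum, coeff_sum] at h
  obtain ⟨k, -, hk⟩ := Finset.exists_ne_zero_of_sum_ne_zero h
  rw [coeff_smul, ← monomial_singleton, coeff_monomial] at hk
  refine ⟨k, ?_, left_ne_zero_of_mul hk⟩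
  by_contra hC
  simp [Ne.symm hC] at hk

lemma exists_of_coeff_e_mul_ne_zero {m : Fin n} {g : Ext K n} {C : Finset (Fin n)}
    (h : coeff (e K m * g) C ≠ 0) : ∃ B, coeff g B ≠ 0 ∧ m ∉ B ∧ C = insert m B := by
  obtain ⟨A, B, hA, hB, hd, rfl⟩ := exists_of_coeff_mul_ne_zero h
  rw [← monomial_singleton, coeff_monomial, ite_ne_right_iff] at hA
  obtain ⟨rfl, -⟩ := hA
  exact ⟨B, hB, by simpa using hd, rfl⟩

lemma e_mul_monomial {m : Fin n} {A : Finset (Fin n)} (h : m ∉ A) :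
    ∃ ε : K, ε ≠ 0 ∧ e K m * monomial K A = ε • monomial K (insert m A) := by
  rw [← monomial_singleton]
  exact monomial_mul_of_disjoint (by simpa using h)

lemma coeff_e_mul_insert_ne_zero {m : Fin n} {A : Finset (Fin n)} (h : m ∉ A) {f : Ext K n}
    (hf : coeff f A ≠ 0) : coeff (e K m * f) (insert m A) ≠ 0 := by
  obtain ⟨ε, hε, h1⟩ := e_mul_monomial (K := K) h
  -- The rest of `f` does not contribute, since `m ∪ B = m ∪ A` and `m ∉ B` force `B = A`.
  have h2 : coeff (e K m * (f - coeff f A • monomial K A)) (insert m A) = 0 := by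
    by_contra h0
    obtain ⟨B, hB, hmB, hAB⟩ := exists_of_coeff_e_mul_ne_zero h0
    have : A = B := by rw [← Finset.erase_insert h, hAB, Finset.erase_insert hmB]
    subst this
    simp at hB
  have h3 : f = coeff f A • monomial K A + (f - coeff f A • monomial K A) := by abel
  rw [h3, mul_add, coeff_add, h2, mul_smul_comm, h1]
  simpa using ⟨hf, hε⟩

/-- A monomial ideal consists of the elements all of whose monomials are divisible by one of the
generators. -/
lemma mem_span_monomial_image {S : Set (Finset (Fin n))} {f : Ext K n} :
    f ∈ Ideal.span (monomial K '' S) ↔ ∀ A, coeff f A ≠ 0 → ∃ B ∈ S, B ⊆ A := by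
  constructor
  · intro hf
    induction hf using Submodule.span_induction with
    | mem x hx =>
      obtain ⟨B, hB, rfl⟩ := hx
      intro A hA
      rw [coeff_monomial, ite_ne_right_iff] at hA
      exact ⟨B, hB, hA.1.le⟩
    | zero => simp
    | add x y _ _ hx hy =>
      intro A hA
      rw [coeff_add] at hA
      by_cases h : coeff x A = 0
      · exact hy A (by simpa [h] using hA)
      · exact hx A h
    | smul a x _ hx =>
      intro A hA
      obtain ⟨C, D, -, hD, -, rfl⟩ := exists_of_coeff_mul_ne_zero hA
      obtain ⟨B, hB, hBD⟩ := hx D hD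
      exact ⟨B, hB, hBD.trans Finset.subset_union_right⟩
  · intro h
    rw [← sum_coeff_smul_monomial f]
    refine Submodule.sum_mem _ fun A _ => ?_
    by_cases hA : coeff f A = 0
    · simp [hA]
    obtain ⟨B, hB, hBA⟩ := h A hA
    obtain ⟨ε, hε, h1⟩ := monomial_mul_of_disjoint (K := K) (Finset.sdiff_disjoint (s := B) (t := A))
    rw [Finset.sdiff_union_of_subset hBA] at h1
    have h2 : coeff f A • monomial K A
        = (coeff f A * ε⁻¹) • (monomial K (A \ B) * monomial K B) := by
      rw [h1, smul_smul, mul_assoc, inv_mul_cancel₀ hε, mul_one]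
    rw [h2, ← smul_mul_assoc]
    exact Ideal.mul_mem_left _ _ (Ideal.subset_span ⟨B, hB, rfl⟩)

lemma monomial_mem_span_monomial_image {S : Set (Finset (Fin n))} {A : Finset (Fin n)} :
    monomial K A ∈ Ideal.span (monomial K '' S) ↔ ∃ B ∈ S, B ⊆ A := by
  simp [mem_span_monomial_image, coeff_monomial]

lemma monomial_mem_exteriorPower (A : Finset (Fin n)) :
    monomial K A ∈ ⋀[K]^A.card (Fin n → K) := by
  rw [monomial_eq_ιMulti A rfl]
  exact ιMulti_range K _ ⟨_, rfl⟩

lemma coeff_ιMulti_ne_zero {d : ℕ} {w : Fin d → Fin n → K} {C : Finset (Fin n)}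
    (h : coeff (ιMulti K d w) C ≠ 0) : C.card = d ∧ ∀ c ∈ C, ∃ k, w k c ≠ 0 := by
  induction d generalizing C with
  | zero =>
    rw [ιMulti_zero_apply, ← monomial_empty, coeff_monomial, ite_ne_right_iff] at h
    obtain ⟨rfl, -⟩ := h
    simp
  | succ d ih =>
    rw [ιMulti_succ_apply] at h
    obtain ⟨A, B, hA, hB, hd, rfl⟩ := exists_of_coeff_mul_ne_zero h
    obtain ⟨k, rfl, hk⟩ := exists_of_coeff_ι_ne_zero hA
    obtain ⟨h1, h2⟩ := ih hB
    refine ⟨by rw [Finset.card_union_of_disjoint hd, h1, Finset.card_singleton, add_comm], ?_⟩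
    intro c hc
    rcases Finset.mem_union.mp hc with hc | hc
    · rw [Finset.mem_singleton.mp hc]
      exact ⟨0, hk⟩
    · obtain ⟨l, hl⟩ := h2 c hc
      exact ⟨l.succ, hl⟩

lemma card_eq_of_coeff_ne_zero {d : ℕ} {f : Ext K n} (hf : f ∈ ⋀[K]^d (Fin n → K))
    {A : Finset (Fin n)} (hA : coeff f A ≠ 0) : A.card = d := by
  rw [← ιMulti_span_fixedDegree] at hf
  induction hf using Submodule.span_induction generalizing A with
  | mem x hx =>
    obtain ⟨w, rfl⟩ := hx
    exact (coeff_ιMulti_ne_zero hA).1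
  | zero => simp at hA
  | add x y _ _ hx hy =>
    by_cases h : coeff x A = 0
    · exact hy (by simpa [h] using hA)
    · exact hx h
  | smul a x _ hx => exact hx (right_ne_zero_of_mul (by simpa using hA))

/-- Splitting off a variable: the part of a form of degree `d + 1` consisting of the monomials that
involve `e_m` is a multiple of `e_m`. -/
lemma exists_e_mul_split (m : Fin n) {d : ℕ} {f : Ext K n} (hf : f ∈ ⋀[K]^(d + 1) (Fin n → K)) :
    ∃ g ∈ ⋀[K]^d (Fin n → K), ∀ A, coeff (f - e K m * g) A = if m ∈ A then 0 else coeff f A := by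
  have h : ∀ A : Finset (Fin n), ∃ g : Ext K n,
      (A.card = d + 1 → m ∈ A → g ∈ ⋀[K]^d (Fin n → K)) ∧
      (m ∈ A → e K m * g = monomial K A) := by
    intro A
    obtain ⟨ε, hε, h1⟩ := e_mul_monomial (K := K) (Finset.notMem_erase m A)
    refine ⟨ε⁻¹ • monomial K (A.erase m), fun hA hm => ?_, fun hm => ?_⟩
    · have h2 := monomial_mem_exteriorPower (K := K) (A.erase m)
      rw [Finset.card_erase_of_mem hm, hA] at h2
      exact Submodule.smul_mem _ _ h2
    · rw [mul_smul_comm, h1, smul_smul, inv_mul_cancel₀ hε, one_smul, Finset.insert_erase hm]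
  choose g hg1 hg2 using h
  refine ⟨∑ A with m ∈ A, coeff f A • g A, Submodule.sum_mem _ fun A hA => ?_, fun A => ?_⟩
  · by_cases h0 : coeff f A = 0
    · simp [h0]
    · exact Submodule.smul_mem _ _ (hg1 A (card_eq_of_coeff_ne_zero hf h0) (by simpa using hA))
  · have h1 : e K m * ∑ A with m ∈ A, coeff f A • g A
        = ∑ A with m ∈ A, coeff f A • monomial K A := by
      rw [Finset.mul_sum]
      refine Finset.sum_congr rfl fun A hA => ?_
      rw [mul_smul_comm, hg2 A (by simpa using hA)]
    rw [h1, coeff_sub, coeff_sum]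
    simp only [coeff_smul, coeff_monomial, mul_ite, mul_one, mul_zero, Finset.sum_ite_eq',
      Finset.mem_filter, Finset.mem_univ, true_and]
    split_ifs <;> simp

end Coefficients

/-! ### Annihilator numbers of monomial ideals -/

section MonomialAnnihilatorNumbers

variable {K : Type*} [Field K] {n : ℕ}

instance : Module.Finite K (Ext K n) :=
  Module.Finite.of_basis (Pi.basisFun K (Fin n)).ExteriorAlgebra

/-- For a monomial ideal `J` and a permutation `v` of the variables, `E/(J + (v_1, …, v_{i-1}))`,
realised as an iterated quotient, is the quotient of `E` by a monomial ideal. -/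
lemma mk_mk_eq_zero_iff {S : Set (Finset (Fin n))} {v : Module.Basis (Fin n) K (Fin n → K)}
    {σ : Fin n → Fin n} (hv : ∀ k, v k = Pi.basisFun K (Fin n) (σ k)) (i : Fin n) (f : Ext K n) :
    (formsSubmodule (Ext K n ⧸ Ideal.span (monomial K '' S)) v i).mkQ
        ((Ideal.span (monomial K '' S)).mkQ f) = 0 ↔
      ∀ A, coeff f A ≠ 0 → (∃ B ∈ S, B ⊆ A) ∨ ∃ k < i, σ k ∈ A := by
  set J : Ideal (Ext K n) := Ideal.span (monomial K '' S)
  set T : Set (Finset (Fin n)) := S ∪ {B | ∃ k < i, B = {σ k}}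
  have hT : f ∈ Ideal.span (monomial K '' T) ↔
      ∀ A, coeff f A ≠ 0 → (∃ B ∈ S, B ⊆ A) ∨ ∃ k < i, σ k ∈ A := by
    rw [mem_span_monomial_image]
    refine forall₂_congr fun A _ => ?_
    constructor
    · rintro ⟨B, hB | ⟨k, hk, rfl⟩, hBA⟩
      · exact .inl ⟨B, hB, hBA⟩
      · exact .inr ⟨k, hk, by simpa using hBA⟩
    · rintro (⟨B, hB, hBA⟩ | ⟨k, hk, hkA⟩)
      · exact ⟨B, .inl hB, hBA⟩
      · exact ⟨{σ k}, .inr ⟨k, hk, rfl⟩, by simpa using hkA⟩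
  have hι : ∀ k, ι K (v k) = e K (σ k) := fun k => by rw [hv, e]
  rw [← hT, Submodule.mkQ_apply, Submodule.Quotient.mk_eq_zero]
  constructor
  · intro h
    have hle : formsSubmodule (Ext K n ⧸ J) v i ≤
        Submodule.map J.mkQ (Ideal.span (monomial K '' T)) := by
      refine Submodule.span_le.2 ?_
      rintro _ ⟨k, hk, m, rfl⟩
      obtain ⟨g, rfl⟩ := J.mkQ_surjective m
      refine ⟨e K (σ k) * g, ?_, by rw [hι, ← smul_eq_mul, map_smul]⟩
      rw [SetLike.mem_coe, mem_span_monomial_image]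
      intro A hA
      obtain ⟨B, -, -, rfl⟩ := exists_of_coeff_e_mul_ne_zero hA
      exact ⟨{σ k}, .inr ⟨k, hk, rfl⟩, by simp⟩
    obtain ⟨g, hg, hgf⟩ := hle h
    rw [← sub_eq_zero, ← map_sub, Submodule.mkQ_apply, Submodule.Quotient.mk_eq_zero] at hgf
    have hJ : g - f ∈ Ideal.span (monomial K '' T) :=
      Ideal.span_mono (Set.image_mono Set.subset_union_left) hgf
    simpa using Submodule.sub_mem _ hg hJ
  · intro h
    have hle : Ideal.span (monomial K '' T) ≤
        (formsSubmodule (Ext K n ⧸ J) v i).comap J.mkQ := by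
      refine Submodule.span_le.2 ?_
      rintro _ ⟨B, hB | ⟨k, hk, rfl⟩, rfl⟩
      · have h0 : J.mkQ (monomial K B) = 0 := by
          rw [Submodule.mkQ_apply, Submodule.Quotient.mk_eq_zero]
          exact Ideal.subset_span ⟨B, hB, rfl⟩
        rw [SetLike.mem_coe, Submodule.mem_comap, h0]
        exact Submodule.zero_mem _
      · refine Submodule.subset_span ⟨k, hk, J.mkQ 1, ?_⟩
        rw [← map_smul, hι, smul_eq_mul, mul_one, monomial_singleton]
    exact hle h

variable {S : Set (Finset (Fin n))} {v : Module.Basis (Fin n) K (Fin n → K)}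
  {σ : Equiv.Perm (Fin n)}

/-- If the variable `v_i` divides no generator of `J`, then the quotient is free over
`K⟨v_i⟩` and multiplication by `v_i` is exact in positive degrees. -/
lemma idealAnnihilatorNumber_eq_zero (hv : ∀ k, v k = Pi.basisFun K (Fin n) (σ k)) {i : Fin n}
    (hS : ∀ B ∈ S, σ i ∉ B) (d : ℕ) :
    idealAnnihilatorNumber (Ideal.span (monomial K '' S)) v i ((d + 1 : ℕ) : ℤ) = 0 := by
  set J : Ideal (Ext K n) := Ideal.span (monomial K '' S)
  have hι : ι K (v i) = e K (σ i) := by rw [hv, e]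
  have key : cycles (quotientGrading (quotientGrading (gradedPart K n) J)
        (formsSubmodule (Ext K n ⧸ J) v i)) (v i) ((d + 1 : ℕ) : ℤ) ≤
      boundaries (quotientGrading (quotientGrading (gradedPart K n) J)
        (formsSubmodule (Ext K n ⧸ J) v i)) (v i) ((d + 1 : ℕ) : ℤ) := by
    rintro x ⟨⟨y, ⟨f, hf, rfl⟩, rfl⟩, hx⟩
    obtain ⟨g, hg, hgf⟩ := exists_e_mul_split (σ i) (show f ∈ ⋀[K]^(d + 1) (Fin n → K) from hf)
    have hx' : (formsSubmodule (Ext K n ⧸ J) v i).mkQ (J.mkQ (e K (σ i) * f)) = 0 := by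
      rw [← hι, ← smul_eq_mul, map_smul, map_smul]
      exact hx
    rw [mk_mk_eq_zero_iff hv] at hx'
    have h0 : (formsSubmodule (Ext K n ⧸ J) v i).mkQ (J.mkQ (f - e K (σ i) * g)) = 0 := by
      rw [mk_mk_eq_zero_iff hv]
      intro A hA
      rw [hgf, ite_ne_left_iff] at hA
      obtain ⟨hiA, hA⟩ := hA
      rcases hx' _ (coeff_e_mul_insert_ne_zero hiA (Ne.symm hA)) with ⟨B, hB, hBA⟩ | ⟨k, hk, hkA⟩
      · exact .inl ⟨B, hB, (Finset.subset_insert_iff_of_notMem (hS B hB)).1 hBA⟩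
      · refine .inr ⟨k, hk, (Finset.mem_insert.1 hkA).resolve_left fun h => hk.ne (σ.injective h)⟩
    rw [map_sub, map_sub, sub_eq_zero] at h0
    refine ⟨(formsSubmodule (Ext K n ⧸ J) v i).mkQ (J.mkQ g), ?_, ?_⟩
    · have hd : ((d + 1 : ℕ) : ℤ) - 1 = (d : ℤ) := by push_cast; ring
      rw [hd]
      exact ⟨_, ⟨g, hg, rfl⟩, rfl⟩
    · refine Eq.trans ?_ h0.symm
      rw [← hι, ← smul_eq_mul, map_smul, map_smul]
      rfl
  have : Subsingleton (Homology (quotientGrading (quotientGrading (gradedPart K n) J)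
      (formsSubmodule (Ext K n ⧸ J) v i)) (v i) ((d + 1 : ℕ) : ℤ)) :=
    Submodule.Quotient.subsingleton_iff.2 (Submodule.submoduleOf_eq_top.2 key)
  exact Module.finrank_zero_of_subsingleton

/-- A monomial that is not divisible by `v_i` and survives in the quotient, but is killed there by
`v_i`, represents a non-zero homology class. -/
lemma idealAnnihilatorNumber_pos (hv : ∀ k, v k = Pi.basisFun K (Fin n) (σ k)) {i : Fin n}
    {A : Finset (Fin n)} (hiA : σ i ∉ A) (hA : ∀ B ∈ S, ¬ B ⊆ A) (hkA : ∀ k < i, σ k ∉ A)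
    (hins : ∃ B ∈ S, B ⊆ insert (σ i) A) :
    0 < idealAnnihilatorNumber (Ideal.span (monomial K '' S)) v i (A.card : ℤ) := by
  set J : Ideal (Ext K n) := Ideal.span (monomial K '' S)
  have hι : ι K (v i) = e K (σ i) := by rw [hv, e]
  have hne : Nontrivial (Homology (quotientGrading (quotientGrading (gradedPart K n) J)
      (formsSubmodule (Ext K n ⧸ J) v i)) (v i) (A.card : ℤ)) := by
    rw [Submodule.Quotient.nontrivial_iff, Ne, Submodule.submoduleOf_eq_top]
    intro hle
    have hcyc : (formsSubmodule (Ext K n ⧸ J) v i).mkQ (J.mkQ (monomial K A)) ∈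
        cycles (quotientGrading (quotientGrading (gradedPart K n) J)
          (formsSubmodule (Ext K n ⧸ J) v i)) (v i) (A.card : ℤ) := by
      refine ⟨⟨_, ⟨_, monomial_mem_exteriorPower A, rfl⟩, rfl⟩, ?_⟩
      have h0 : (formsSubmodule (Ext K n ⧸ J) v i).mkQ (J.mkQ (e K (σ i) * monomial K A)) = 0 := by
        rw [mk_mk_eq_zero_iff hv]
        intro C hC
        obtain ⟨B, hB, -, rfl⟩ := exists_of_coeff_e_mul_ne_zero hC
        rw [coeff_monomial, ite_ne_right_iff] at hB
        exact .inl (hB.1 ▸ hins)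
      rw [← hι, ← smul_eq_mul, map_smul, map_smul] at h0
      exact h0
    obtain ⟨_, ⟨_, ⟨g, -, rfl⟩, rfl⟩, hg⟩ := hle hcyc
    have h0 : (formsSubmodule (Ext K n ⧸ J) v i).mkQ
        (J.mkQ (monomial K A - e K (σ i) * g)) = 0 := by
      rw [map_sub, map_sub, sub_eq_zero, ← hι, ← smul_eq_mul, map_smul, map_smul]
      exact hg.symm
    rw [mk_mk_eq_zero_iff hv] at h0
    have hcoeff : coeff (e K (σ i) * g) A = 0 := by
      by_contra hc
      obtain ⟨B, -, -, rfl⟩ := exists_of_coeff_e_mul_ne_zero hc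
      exact hiA (Finset.mem_insert_self _ _)
    rcases h0 A (by simp [hcoeff]) with ⟨B, hB, hBA⟩ | ⟨k, hk, hk'⟩
    · exact hA B hB hBA
    · exact hkA k hk hk'
  exact Module.finrank_pos

end MonomialAnnihilatorNumbers

/-! ### The reverse lexicographic order -/

section RevLex

variable {n : ℕ}

lemma RevLexLT.trans {A B C : Finset (Fin n)} (h : RevLexLT A B) (h' : RevLexLT B C) :
    RevLexLT A C := by
  rcases h with h | ⟨h, a, ha, hab⟩
  · rcases h' with h' | ⟨h', -⟩
    · exact .inl (h.trans h')
    · exact .inl (h' ▸ h)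
  · rcases h' with h' | ⟨h', b, hb, hbc⟩
    · exact .inl (h ▸ h')
    · refine .inr ⟨h.trans h', min a b, ?_⟩
      simp only [Finset.mem_sdiff] at *
      grind

lemma RevLexLT.irrefl (A : Finset (Fin n)) : ¬ RevLexLT A A := by
  rintro (h | ⟨-, a, ha, -⟩)
  · exact lt_irrefl _ h
  · simp at ha

/-- Trading variables of `A` that are at least `e_i` for variables smaller than `e_i` makes a
monomial smaller. -/
lemma revLexLT_of_sdiff {A C : Finset (Fin n)} {i : Fin n} (hne : C ≠ A) (hcard : C.card = A.card)
    (hC : ∀ c ∈ C \ A, c < i) (hA : ∀ a ∈ A \ C, i ≤ a) : RevLexLT C A := by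
  refine .inr ⟨hcard, ?_⟩
  have hnon : (C \ A).Nonempty := by
    rw [Finset.sdiff_nonempty]
    exact fun h => hne (Finset.eq_of_subset_of_card_le h hcard.ge)
  obtain ⟨c, hc⟩ := hnon
  exact ⟨c, hc, fun a ha => (hC c hc).trans_le (hA a ha)⟩

end RevLex

/-! ### Unipotent substitutions preserve initial monomials -/

section Unipotent

variable {K : Type*} [Field K] {n : ℕ} {i : Fin n} {c : (Fin n → K) →ₗ[K] (Fin n → K)}

/-- Under the substitution `e_a ↦ e_a + c(e_a)`, where `c(e_a)` is a combination of the variables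
below `e_i` and vanishes for `a < i`, a monomial changes only by monomials that arise from it by
trading variables `e_a`, `a ≥ i`, for variables below `e_i`. -/
lemma coeff_map_monomial_sub (hc : ∀ x l, i ≤ l → c x l = 0)
    (hc0 : ∀ a < i, c (Pi.basisFun K (Fin n) a) = 0) (A : Finset (Fin n)) :
    ∀ C, coeff (ExteriorAlgebra.map (LinearMap.id + c) (monomial K A) - monomial K A) C ≠ 0 →
      C ≠ A ∧ C.card = A.card ∧ (∀ b ∈ C \ A, b < i) ∧ ∀ a ∈ A \ C, i ≤ a := by
  induction A using Finset.induction_on with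
  | empty => intro C; simp [monomial_empty]
  | insert a A ha ih =>
    intro C hC
    obtain ⟨ε, hε, hmon⟩ := e_mul_monomial (K := K) ha
    set u := ExteriorAlgebra.map (LinearMap.id + c)
    set w : Ext K n := ι K (c (Pi.basisFun K (Fin n) a))
    set r : Ext K n := u (monomial K A) - monomial K A
    have hue : u (e K a) = e K a + w := by simp [u, w, e]
    have huA : u (monomial K A) = monomial K A + r := by simp [r]
    have hexp : ε • (u (monomial K (insert a A)) - monomial K (insert a A)) =
        w * monomial K A + (e K a * r + w * r) := by
      rw [smul_sub, ← map_smul, ← hmon, map_mul, hue, huA, add_mul, mul_add, mul_add]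
      abel
    have hC' : coeff (w * monomial K A + (e K a * r + w * r)) C ≠ 0 := by
      rw [← hexp, coeff_smul]
      exact mul_ne_zero hε hC
    -- The monomials of `w` are variables `e_b` with `b < i`, and `w = 0` unless `i ≤ a`.
    have hw : ∀ B, coeff w B ≠ 0 → ∃ b < i, i ≤ a ∧ B = {b} := by
      intro B hB
      obtain ⟨b, rfl, hb⟩ := exists_of_coeff_ι_ne_zero hB
      refine ⟨b, ?_, ?_, rfl⟩
      · by_contra h
        exact hb (hc _ _ (not_lt.1 h))
      · by_contra h
        rw [hc0 a (not_le.1 h)] at hb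
        exact hb rfl
    have hcases : coeff (w * monomial K A) C ≠ 0 ∨ coeff (e K a * r) C ≠ 0 ∨
        coeff (w * r) C ≠ 0 := by
      by_contra! h
      simp [h.1, h.2.1, h.2.2] at hC'
    rcases hcases with h | h | h
    · obtain ⟨B, D, hB, hD, hBD, rfl⟩ := exists_of_coeff_mul_ne_zero h
      obtain ⟨b, hbi, hia, rfl⟩ := hw B hB
      rw [coeff_monomial, ite_ne_right_iff] at hD
      obtain ⟨rfl, -⟩ := hD
      have hbA : b ∉ A := by simpa using hBD
      rw [Finset.singleton_union]
      refine ⟨?_, by rw [Finset.card_insert_of_notMem hbA, Finset.card_insert_of_notMem ha], ?_, ?_⟩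
      · intro h
        have hb : b ∈ insert a A := h ▸ Finset.mem_insert_self b A
        exact hbA ((Finset.mem_insert.1 hb).resolve_left (hbi.trans_le hia).ne)
      · grind
      · grind
    · obtain ⟨D, hD, haD, rfl⟩ := exists_of_coeff_e_mul_ne_zero h
      obtain ⟨h1, h2, h3, h4⟩ := ih D hD
      refine ⟨?_, by rw [Finset.card_insert_of_notMem haD, Finset.card_insert_of_notMem ha, h2],
        ?_, ?_⟩
      · intro h
        exact h1 (by rw [← Finset.erase_insert haD, h, Finset.erase_insert ha])
      · grind
      · grind
    · obtain ⟨B, D, hB, hD, hBD, rfl⟩ := exists_of_coeff_mul_ne_zero h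
      obtain ⟨b, hbi, hia, rfl⟩ := hw B hB
      have hbD : b ∉ D := by simpa using hBD
      obtain ⟨h1, h2, h3, h4⟩ := ih D hD
      rw [Finset.singleton_union]
      refine ⟨?_, by rw [Finset.card_insert_of_notMem hbD, Finset.card_insert_of_notMem ha, h2],
        ?_, ?_⟩
      · -- Otherwise `b ∈ A \ D`, so `i ≤ b`.
        intro h
        have hb : b ∈ insert a A := h ▸ Finset.mem_insert_self b D
        have hbA : b ∈ A := (Finset.mem_insert.1 hb).resolve_left (hbi.trans_le hia).ne
        exact absurd (h4 b (Finset.mem_sdiff.2 ⟨hbA, hbD⟩)) (not_le.2 hbi)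
      · grind
      · grind

lemma isInitialMonomial_map_monomial (hc : ∀ x l, i ≤ l → c x l = 0)
    (hc0 : ∀ a < i, c (Pi.basisFun K (Fin n) a) = 0) (A : Finset (Fin n)) :
    IsInitialMonomial (ExteriorAlgebra.map (LinearMap.id + c) (monomial K A)) A := by
  have key := coeff_map_monomial_sub hc hc0 A
  have h1 : ∀ B, coeff (ExteriorAlgebra.map (LinearMap.id + c) (monomial K A)) B =
      coeff (monomial K A) B +
        coeff (ExteriorAlgebra.map (LinearMap.id + c) (monomial K A) - monomial K A) B := by
    intro B
    rw [← coeff_add]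
    simp
  constructor
  · have : coeff (ExteriorAlgebra.map (LinearMap.id + c) (monomial K A) - monomial K A) A = 0 := by
      by_contra h
      exact (key A h).1 rfl
    simp [h1, this]
  · intro B hB hBA
    rw [h1, coeff_monomial, if_neg (Ne.symm hBA), zero_add] at hB
    obtain ⟨h2, h3, h4, h5⟩ := key B hB
    exact revLexLT_of_sdiff h2 h3 h4 h5

/-- The initial monomial of `u(g)`, for a unipotent substitution `u`, occurs in `g`. -/
lemma coeff_ne_zero_of_isInitialMonomial_map (hc : ∀ x l, i ≤ l → c x l = 0)
    (hc0 : ∀ a < i, c (Pi.basisFun K (Fin n) a) = 0) {g : Ext K n} {A : Finset (Fin n)}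
    (hA : IsInitialMonomial (ExteriorAlgebra.map (LinearMap.id + c) g) A) : coeff g A ≠ 0 := by
  set u := ExteriorAlgebra.map (LinearMap.id + c)
  have hexp : ∀ C, coeff (u g) C = ∑ B, coeff g B * coeff (u (monomial K B)) C := by
    intro C
    conv_lhs => rw [← sum_coeff_smul_monomial g, map_sum, coeff_sum]
    simp only [map_smul, coeff_smul]
  obtain ⟨B, -, hB⟩ := Finset.exists_ne_zero_of_sum_ne_zero (hexp A ▸ hA.1)
  have hBg := left_ne_zero_of_mul hB
  have hBA := right_ne_zero_of_mul hB
  -- `C` is the initial monomial of `g`; it is at least `B`, which is at least `A`.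
  obtain ⟨C, hC, hBC, hmax⟩ : ∃ C, coeff g C ≠ 0 ∧ (B = C ∨ RevLexLT B C) ∧
      ∀ D, coeff g D ≠ 0 → ¬ RevLexLT C D := by
    let : PartialOrder (Finset (Fin n)) :=
      { le := fun D D' => D = D' ∨ RevLexLT D D'
        lt := RevLexLT
        lt_iff_le_not_ge := by
          refine fun D D' => ⟨fun h => ⟨.inr h, ?_⟩, ?_⟩
          · rintro (rfl | h')
            · exact RevLexLT.irrefl _ h
            · exact RevLexLT.irrefl _ (h.trans h')
          · rintro ⟨rfl | h, h'⟩
            · exact absurd (.inl rfl) h'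
            · exact h
        le_refl := fun _ => .inl rfl
        le_trans := by
          rintro D D' D'' (rfl | h) (rfl | h')
          · exact .inl rfl
          · exact .inr h'
          · exact .inr h
          · exact .inr (h.trans h')
        le_antisymm := by
          rintro D D' (rfl | h) (h' | h')
          · rfl
          · rfl
          · exact h'.symm
          · exact absurd (h.trans h') (RevLexLT.irrefl _) }
    obtain ⟨C, hBC, hC⟩ :=
      (Set.toFinite {D : Finset (Fin n) | coeff g D ≠ 0}).exists_le_maximal hBg
    refine ⟨C, hC.prop, hBC, fun D hD hCD => ?_⟩
    have : D = C := (hC.eq_of_le hD (.inr hCD)).symm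
    exact RevLexLT.irrefl C (this ▸ hCD)
  have hCcoeff : coeff (u g) C ≠ 0 := by
    rw [hexp, Finset.sum_eq_single C]
    · exact mul_ne_zero hC (isInitialMonomial_map_monomial hc hc0 C).1
    · intro D _ hDC
      by_contra h
      exact hmax D (left_ne_zero_of_mul h)
        ((isInitialMonomial_map_monomial hc hc0 D).2 C (right_ne_zero_of_mul h) (Ne.symm hDC))
    · simp
  by_cases hCA : C = A
  · exact hCA ▸ hC
  have h1 : RevLexLT C A := hA.2 C hCcoeff hCA
  by_cases hAB : A = B
  · exact hAB ▸ hBg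
  have h2 : RevLexLT A B := (isInitialMonomial_map_monomial hc hc0 B).2 A hBA hAB
  rcases hBC with rfl | h3
  · exact absurd (h1.trans h2) (RevLexLT.irrefl _)
  · exact absurd ((h1.trans h2).trans h3) (RevLexLT.irrefl _)

end Unipotent

/-! ### The generic initial ideal of a power of an ideal of variables -/

section Gin

variable {K : Type*} [Field K] {n : ℕ}

/-- The ideal generated by the products of `d` linear forms in the subspace `W`. -/
def powerIdeal (W : Submodule K (Fin n → K)) (d : ℕ) : Ideal (Ext K n) :=
  Ideal.span {x | ∃ w : Fin d → Fin n → K, (∀ k, w k ∈ W) ∧ x = ιMulti K d w}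

lemma map_powerIdeal (W : Submodule K (Fin n → K)) (d : ℕ) (f : (Fin n → K) →ₗ[K] (Fin n → K)) :
    (powerIdeal W d).map (ExteriorAlgebra.map f) = powerIdeal (W.map f) d := by
  rw [powerIdeal, Ideal.map_span, powerIdeal]
  congr 1
  ext x
  constructor
  · rintro ⟨_, ⟨w, hw, rfl⟩, rfl⟩
    exact ⟨f ∘ w, fun k => ⟨w k, hw k, rfl⟩, map_apply_ιMulti f w⟩
  · rintro ⟨w, hw, rfl⟩
    choose w' hw' hfw using hw
    refine ⟨_, ⟨w', hw', rfl⟩, ?_⟩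
    rw [map_apply_ιMulti]
    congr 1
    exact funext hfw

/-- The inclusion into `E_1` of the span of the variables `e_l`, `l ≥ i`. -/
noncomputable def tailIncl (K : Type*) [Field K] {n : ℕ} (i : Fin n) :
    ({l : Fin n // i ≤ l} → K) →ₗ[K] (Fin n → K) :=
  Function.ExtendByZero.linearMap K Subtype.val

/-- The projection of `E_1` onto the span of the variables `e_l`, `l ≥ i`. -/
def tailProj (K : Type*) [Field K] {n : ℕ} (i : Fin n) :
    (Fin n → K) →ₗ[K] ({l : Fin n // i ≤ l} → K) :=
  LinearMap.funLeft K K Subtype.val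

lemma tailIncl_apply {i : Fin n} (x : {l : Fin n // i ≤ l} → K) (l : {l : Fin n // i ≤ l}) :
    tailIncl K i x l = x l := by
  simp [tailIncl]

lemma tailIncl_apply_of_lt {i : Fin n} (x : {l : Fin n // i ≤ l} → K) {l : Fin n} (hl : l < i) :
    tailIncl K i x l = 0 := by
  simp only [tailIncl, Function.ExtendByZero.linearMap_apply]
  rw [Function.extend_apply' _ _ _ (by rintro ⟨⟨a, ha⟩, rfl⟩; exact absurd hl (not_lt.2 ha))]
  rfl

lemma tailProj_apply {i : Fin n} (x : Fin n → K) (l : {l : Fin n // i ≤ l}) :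
    tailProj K i x l = x l := rfl

lemma tailProj_tailIncl {i : Fin n} (x : {l : Fin n // i ≤ l} → K) :
    tailProj K i (tailIncl K i x) = x :=
  funext fun l => by rw [tailProj_apply, tailIncl_apply]

lemma exampleIdeal_eq_span_image (i : Fin n) (j : ℕ) :
    exampleIdeal K i j = Ideal.span (monomial K '' {A | A.card = j + 1 ∧ ∀ l ∈ A, i ≤ l}) := by
  rw [exampleIdeal]
  congr 1
  ext x
  simp only [Set.mem_ofPred_eq, Set.mem_image]
  constructor
  · rintro ⟨A, h1, h2, rfl⟩
    exact ⟨A, ⟨h1, h2⟩, rfl⟩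
  · rintro ⟨A, ⟨h1, h2⟩, rfl⟩
    exact ⟨A, h1, h2, rfl⟩

lemma exampleIdeal_eq_powerIdeal (i : Fin n) (j : ℕ) :
    exampleIdeal K i j = powerIdeal (LinearMap.range (tailIncl K i)) (j + 1) := by
  apply le_antisymm
  · refine Ideal.span_le.2 ?_
    rintro _ ⟨A, hA, hAi, rfl⟩
    refine Ideal.subset_span ⟨_, fun k => ?_, monomial_eq_ιMulti A hA⟩
    have hk := hAi _ (Finset.orderEmbOfFin_mem A hA k)
    refine ⟨Pi.single ⟨_, hk⟩ 1, ?_⟩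
    ext l
    rcases lt_or_ge l i with hl | hl
    · rw [tailIncl_apply_of_lt _ hl, Pi.basisFun_apply, Pi.single_eq_of_ne (hl.trans_le hk).ne]
    · rw [tailIncl_apply _ ⟨l, hl⟩, Pi.basisFun_apply]
      simp [Pi.single_apply, Subtype.ext_iff]
  · refine Ideal.span_le.2 ?_
    rintro _ ⟨w, hw, rfl⟩
    rw [exampleIdeal_eq_span_image, SetLike.mem_coe, mem_span_monomial_image]
    intro A hA
    obtain ⟨h1, h2⟩ := coeff_ιMulti_ne_zero hA
    refine ⟨A, ⟨h1, fun l hl => ?_⟩, subset_rfl⟩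
    obtain ⟨k, hk⟩ := h2 l hl
    by_contra h
    obtain ⟨x, hx⟩ := hw k
    exact hk (hx ▸ tailIncl_apply_of_lt x (not_le.1 h))

/-- If the block of `φ` on the variables `e_l`, `l ≥ i`, is invertible, then `φ` maps the span `W`
of these variables onto the graph of a linear map from `W` to the span of the remaining ones, that
is, onto the image of `W` under a unipotent map. -/
lemma exists_map_range_eq {i : Fin n} (f : (Fin n → K) →ₗ[K] (Fin n → K))
    (hf : Function.Bijective (tailProj K i ∘ₗ f ∘ₗ tailIncl K i)) :
    ∃ c : (Fin n → K) →ₗ[K] (Fin n → K), (∀ x l, i ≤ l → c x l = 0) ∧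
      (∀ x, (∀ l, i ≤ l → x l = 0) → c x = 0) ∧
      (LinearMap.range (tailIncl K i)).map f =
        (LinearMap.range (tailIncl K i)).map (LinearMap.id + c) := by
  set β := LinearEquiv.ofBijective _ hf
  have hβ : ∀ x, tailProj K i (f (tailIncl K i (β.symm x))) = x := fun x => β.apply_symm_apply x
  refine ⟨(LinearMap.id - tailIncl K i ∘ₗ tailProj K i) ∘ₗ f ∘ₗ tailIncl K i ∘ₗ
    β.symm.toLinearMap ∘ₗ tailProj K i, ?_, ?_, ?_⟩
  · intro x l hl
    have := tailIncl_apply (K := K) (tailProj K i (f (tailIncl K i (β.symm (tailProj K i x)))))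
      ⟨l, hl⟩
    simp only [tailProj_apply] at this
    simp [this]
  · intro x hx
    have : tailProj K i x = 0 := funext fun l => hx l l.2
    simp [this]
  · have hu : ∀ x, tailIncl K i x + ((LinearMap.id - tailIncl K i ∘ₗ tailProj K i) ∘ₗ f ∘ₗ
        tailIncl K i ∘ₗ β.symm.toLinearMap ∘ₗ tailProj K i) (tailIncl K i x) =
        f (tailIncl K i (β.symm x)) := by
      intro x
      simp [tailProj_tailIncl, hβ]
    apply le_antisymm
    · rintro _ ⟨_, ⟨x, rfl⟩, rfl⟩
      refine ⟨tailIncl K i (β x), ⟨_, rfl⟩, ?_⟩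
      simpa using hu (β x)
    · rintro _ ⟨_, ⟨x, rfl⟩, rfl⟩
      exact ⟨_, ⟨β.symm x, rfl⟩, (hu x).symm⟩

lemma initialIdeal_transform_exampleIdeal {i : Fin n} (j : ℕ) (φ : GL (Fin n) K)
    (hφ : Function.Bijective
      (tailProj K i ∘ₗ Matrix.toLin' (φ : Matrix (Fin n) (Fin n) K) ∘ₗ tailIncl K i)) :
    initialIdeal (transform φ (exampleIdeal K i j)) = exampleIdeal K i j := by
  obtain ⟨c, hc, hc', hmap⟩ := exists_map_range_eq _ hφ
  have hc0 : ∀ a < i, c (Pi.basisFun K (Fin n) a) = 0 := fun a ha =>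
    hc' _ fun l hl => by simp [(ha.trans_le hl).ne']
  have htrans : transform φ (exampleIdeal K i j) =
      (exampleIdeal K i j).map (ExteriorAlgebra.map (LinearMap.id + c)) := by
    rw [transform, exampleIdeal_eq_powerIdeal, map_powerIdeal, map_powerIdeal, hmap]
  -- `c` squares to zero, so `id - c` is an inverse of `id + c`.
  have hsurj : Function.Surjective (ExteriorAlgebra.map (LinearMap.id + c)) := by
    rw [map_surjective_iff]
    intro x
    refine ⟨x - c x, ?_⟩
    simp [hc' (c x) (fun l hl => hc x l hl)]
  apply le_antisymm
  · refine Ideal.span_le.2 ?_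
    rintro _ ⟨f, hf, A, hA, rfl⟩
    rw [htrans, Ideal.mem_map_iff_of_surjective _ hsurj] at hf
    obtain ⟨g, hg, rfl⟩ := hf
    have hgA := coeff_ne_zero_of_isInitialMonomial_map hc hc0 hA
    rw [exampleIdeal_eq_span_image] at hg ⊢
    exact monomial_mem_span_monomial_image.2 (mem_span_monomial_image.1 hg A hgA)
  · refine Ideal.span_le.2 ?_
    rintro _ ⟨A, h1, h2, rfl⟩
    refine Ideal.subset_span ⟨_, ?_, A, isInitialMonomial_map_monomial hc hc0 A, rfl⟩
    rw [htrans]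
    exact Ideal.mem_map_of_mem _ (Ideal.subset_span ⟨A, h1, h2, rfl⟩)

lemma tail_block_eq_toLin {i : Fin n} (M : Matrix (Fin n) (Fin n) K) :
    tailProj K i ∘ₗ Matrix.toLin' M ∘ₗ tailIncl K i =
      Matrix.toLin' (M.submatrix (Subtype.val : {l // i ≤ l} → Fin n) Subtype.val) := by
  apply LinearMap.ext
  intro x
  ext l
  simp only [LinearMap.comp_apply, Matrix.toLin'_apply, tailProj_apply, Matrix.mulVec,
    dotProduct, Matrix.submatrix_apply]
  refine (Fintype.sum_of_injective Subtype.val Subtype.val_injective _ _ ?_ ?_).symm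
  · intro k hk
    rw [tailIncl_apply_of_lt _ (not_le.1 fun h => hk ⟨⟨k, h⟩, rfl⟩), mul_zero]
  · intro k
    rw [tailIncl_apply]

lemma isGenericInitialIdeal_exampleIdeal (i : Fin n) (j : ℕ) :
    IsGenericInitialIdeal (exampleIdeal K i j) (exampleIdeal K i j) := by
  let P : MvPolynomial (Fin n × Fin n) K := Matrix.det (Matrix.of
    fun (a b : {l : Fin n // i ≤ l}) => MvPolynomial.X (a.1, b.1))
  have hP : ∀ M : Matrix (Fin n) (Fin n) K, MvPolynomial.eval (fun ab => M ab.1 ab.2) P =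
      (M.submatrix (Subtype.val : {l // i ≤ l} → Fin n) Subtype.val).det := by
    intro M
    rw [RingHom.map_det]
    congr 1
    ext a b
    simp
  refine ⟨_, ⟨{P}, rfl⟩, ⟨1, P, rfl, ?_⟩, ?_⟩
  · rw [hP, Units.val_one, Matrix.submatrix_one _ Subtype.val_injective, Matrix.det_one]
    exact one_ne_zero
  · rintro φ ⟨_, rfl, hφ⟩
    rw [hP] at hφ
    apply initialIdeal_transform_exampleIdeal
    rw [tail_block_eq_toLin]
    have hu : IsUnit (Matrix.submatrix (φ : Matrix (Fin n) (Fin n) K)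
        (Subtype.val : {l // i ≤ l} → Fin n) Subtype.val) :=
      (Matrix.isUnit_iff_isUnit_det _).2 hφ.isUnit
    refine ⟨?_, ?_⟩
    · exact Matrix.mulVec_injective_iff_isUnit.2 hu
    · exact Matrix.mulVec_surjective_iff_isUnit.2 hu

/-- Over an infinite field two non-empty Zariski-open subsets of `GL_n` meet, so the generic initial
ideal is unique. -/
lemma IsGenericInitialIdeal.unique [Infinite K] {J I I' : Ideal (Ext K n)}
    (h : IsGenericInitialIdeal J I) (h' : IsGenericInitialIdeal J I') : I = I' := by
  obtain ⟨_, ⟨S, rfl⟩, ⟨φ, P, hP, hφ⟩, hI⟩ := h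
  obtain ⟨_, ⟨S', rfl⟩, ⟨φ', P', hP', hφ'⟩, hI'⟩ := h'
  let D : MvPolynomial (Fin n × Fin n) K := Matrix.det (Matrix.of fun a b => MvPolynomial.X (a, b))
  have hD : ∀ M : Matrix (Fin n) (Fin n) K, MvPolynomial.eval (fun ab => M ab.1 ab.2) D =
      M.det := by
    intro M
    rw [RingHom.map_det]
    congr 1
    ext a b
    simp
  have hP0 : P ≠ 0 := by rintro rfl; simp at hφ
  have hP0' : P' ≠ 0 := by rintro rfl; simp at hφ'
  have hD0 : D ≠ 0 := by
    intro h0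
    have := hD 1
    simp [h0] at this
  have hne : P * P' * D ≠ 0 := mul_ne_zero (mul_ne_zero hP0 hP0') hD0
  obtain ⟨x, hx⟩ : ∃ x, MvPolynomial.eval x (P * P' * D) ≠ 0 := by
    by_contra! h0
    exact hne (MvPolynomial.funext fun x => by simp [h0 x])
  have hxM : x = fun ab => (Matrix.of fun a b => x (a, b)) ab.1 ab.2 := rfl
  rw [map_mul, map_mul] at hx
  have hdet := right_ne_zero_of_mul hx
  rw [hxM, hD] at hdet
  let ψ := Matrix.GeneralLinearGroup.mkOfDetNeZero (Matrix.of fun a b => x (a, b)) hdet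
  rw [← hI ψ ⟨P, hP, left_ne_zero_of_mul (left_ne_zero_of_mul hx)⟩,
    ← hI' ψ ⟨P', hP', right_ne_zero_of_mul (left_ne_zero_of_mul hx)⟩]

lemma IsGenericInitialIdeal.gin_eq [Infinite K] {J I : Ideal (Ext K n)}
    (h : IsGenericInitialIdeal J I) : gin J = I :=
  (Classical.epsilon_spec ⟨I, h⟩ : IsGenericInitialIdeal J (gin J)).unique h

end Gin

/-! ### Annihilator numbers of the example -/

section Example

variable {K : Type*} [Field K] {n : ℕ}

lemma isGraded_exampleIdeal (i : Fin n) (j : ℕ) : IsGraded (exampleIdeal K i j) := by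
  refine Ideal.homogeneous_span _ _ ?_
  rintro _ ⟨A, -, -, rfl⟩
  exact ⟨A.card, monomial_mem_exteriorPower A⟩

lemma isStronglyStable_exampleIdeal (i : Fin n) (j : ℕ) :
    IsStronglyStable (exampleIdeal K i j) := by
  refine ⟨⟨_, exampleIdeal_eq_span_image i j⟩, fun A hA a ha b hb hab => ?_⟩
  obtain ⟨ε, -, hmon⟩ := e_mul_monomial (K := K) (mt Finset.mem_of_mem_erase hb : b ∉ A.erase a)
  rw [hmon, exampleIdeal_eq_span_image]
  rw [exampleIdeal_eq_span_image, monomial_mem_span_monomial_image] at hA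
  obtain ⟨B, ⟨hB, hBi⟩, hBA⟩ := hA
  refine Submodule.smul_of_tower_mem _ ε (monomial_mem_span_monomial_image.2 ?_)
  by_cases haB : a ∈ B
  · have hbB : b ∉ B.erase a := fun h => hb (hBA (Finset.mem_of_mem_erase h))
    refine ⟨insert b (B.erase a), ⟨?_, ?_⟩, Finset.insert_subset_insert _
      (Finset.erase_subset_erase _ hBA)⟩
    · rw [Finset.card_insert_of_notMem hbB, Finset.card_erase_add_one haB, hB]
    · intro l hl
      rcases Finset.mem_insert.1 hl with rfl | hl
      · exact (hBi a haB).trans hab.le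
      · exact hBi l (Finset.mem_of_mem_erase hl)
  · exact ⟨B, ⟨hB, hBi⟩, (Finset.subset_erase.2 ⟨hBA, haB⟩).trans (Finset.subset_insert _ _)⟩

/-- If the variable `v_k` is smaller than `e_i`, it divides no generator of the ideal. -/
lemma idealAnnihilatorNumber_exampleIdeal_eq_zero {v : Module.Basis (Fin n) K (Fin n → K)}
    {σ : Equiv.Perm (Fin n)} (hv : ∀ k, v k = Pi.basisFun K (Fin n) (σ k)) {i k : Fin n}
    (hk : σ k < i) {j : ℕ} (hj : 1 ≤ j) :
    idealAnnihilatorNumber (exampleIdeal K i j) v k (j : ℤ) = 0 := by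
  obtain ⟨d, rfl⟩ := Nat.exists_eq_add_of_le' hj
  rw [exampleIdeal_eq_span_image]
  exact idealAnnihilatorNumber_eq_zero hv (fun B hB h => not_le.2 hk (hB.2 _ h)) d

/-- If `v_k = e_i` is preceded only by variables smaller than `e_i`, the monomial
`e_{i+1} ⋯ e_{i+j}` represents a non-zero homology class. -/
lemma idealAnnihilatorNumber_exampleIdeal_pos {v : Module.Basis (Fin n) K (Fin n → K)}
    {σ : Equiv.Perm (Fin n)} (hv : ∀ k, v k = Pi.basisFun K (Fin n) (σ k)) {i k : Fin n}
    (hk : σ k = i) (hlt : ∀ l < k, σ l < i) {j : ℕ} (hij : ((i : ℕ) + 1) + j ≤ n) :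
    0 < idealAnnihilatorNumber (exampleIdeal K i j) v k (j : ℤ) := by
  set A : Finset (Fin n) := Finset.Ioc i ⟨i + j, by omega⟩
  have hcard : A.card = j := by simp [A]
  have hiA : i ∉ A := by simp [A]
  rw [exampleIdeal_eq_span_image]
  have := idealAnnihilatorNumber_pos (S := {A | A.card = j + 1 ∧ ∀ l ∈ A, i ≤ l}) hv (i := k)
    (A := A) (hk ▸ hiA) ?_ ?_ ?_
  · rwa [hcard] at this
  · rintro B ⟨hB, -⟩ hBA
    have := Finset.card_le_card hBA
    omega
  · intro l hl h
    exact (hlt l hl).not_gt (Finset.mem_Ioc.1 h).1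
  · refine ⟨_, ⟨?_, ?_⟩, subset_rfl⟩
    · rw [hk, Finset.card_insert_of_notMem hiA, hcard]
    · intro l hl
      rcases Finset.mem_insert.1 hl with rfl | hl
      · exact hk.ge
      · exact (Finset.mem_Ioc.1 hl).1.le

end Example

end ExtAnn

open ExtAnn in
theorem mainTheorem11 {K : Type*} [Field K] [Infinite K] {n : ℕ}
    (i' i : Fin n) (j : ℕ)
    -- in one-based numbering, `i` is an index with `2 ≤ i` and `i'` is the index `i - 1`
    (hi : (i : ℕ) = (i' : ℕ) + 1)
    (hj : 1 ≤ j)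
    -- in one-based numbering: `i + j ≤ n`
    (hij : ((i : ℕ) + 1) + j ≤ n) :
    ExtAnn.IsGraded (ExtAnn.exampleIdeal K i j) ∧
    ExtAnn.IsStronglyStable (ExtAnn.exampleIdeal K i j) ∧
    ExtAnn.IsGenericInitialIdeal (ExtAnn.exampleIdeal K i j) (ExtAnn.exampleIdeal K i j) ∧
    ExtAnn.gin (ExtAnn.exampleIdeal K i j) = ExtAnn.exampleIdeal K i j ∧
    ExtAnn.idealAnnihilatorNumber (ExtAnn.exampleIdeal K i j) (ExtAnn.swappedBasis K i' i) i j <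
      ExtAnn.genericAnnihilatorNumber (ExtAnn.exampleIdeal K i j) i j ∧
    ExtAnn.genericAnnihilatorNumber (ExtAnn.exampleIdeal K i j) i' j <
      ExtAnn.idealAnnihilatorNumber (ExtAnn.exampleIdeal K i j) (ExtAnn.swappedBasis K i' i) i' j ∧
    ¬ ExtAnn.HerzogConjecture K n := by
  have hgin := isGenericInitialIdeal_exampleIdeal (K := K) i j
  have hlt : i' < i := Fin.lt_def.2 (by omega)
  have hstd : ∀ k, Pi.basisFun K (Fin n) k =
      Pi.basisFun K (Fin n) (Equiv.refl (Fin n) k) := fun _ => rfl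
  have hswap : ∀ k, swappedBasis K i' i k = Pi.basisFun K (Fin n) (Equiv.swap i' i k) := by
    intro k
    rw [swappedBasis, Module.Basis.reindex_apply, Equiv.symm_swap]
  have hlow : ∀ l < i', Equiv.swap i' i l < i := fun l hl => by
    rw [Equiv.swap_apply_of_ne_of_ne hl.ne (hl.trans hlt).ne]
    exact hl.trans hlt
  have h1 : idealAnnihilatorNumber (exampleIdeal K i j) (swappedBasis K i' i) i j <
      genericAnnihilatorNumber (exampleIdeal K i j) i j := by
    rw [genericAnnihilatorNumber, hgin.gin_eq,
      idealAnnihilatorNumber_exampleIdeal_eq_zero hswap (by simpa using hlt) hj]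
    exact idealAnnihilatorNumber_exampleIdeal_pos hstd rfl (fun _ h => h) hij
  have h2 : genericAnnihilatorNumber (exampleIdeal K i j) i' j <
      idealAnnihilatorNumber (exampleIdeal K i j) (swappedBasis K i' i) i' j := by
    rw [genericAnnihilatorNumber, hgin.gin_eq,
      idealAnnihilatorNumber_exampleIdeal_eq_zero hstd hlt hj]
    exact idealAnnihilatorNumber_exampleIdeal_pos hswap (Equiv.swap_apply_left _ _) hlow hij
  exact ⟨isGraded_exampleIdeal i j, isStronglyStable_exampleIdeal i j, hgin, hgin.gin_eq, h1, h2,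
    fun h => (h _ (isGraded_exampleIdeal i j) (swappedBasis K i' i) i j).not_gt h1⟩
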